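/- For a partition $\lambda$ of a positive integer, let $o(\lambda)$ be the number of ones in $\lambda$ and $\mu(\lambda)$ the number of parts of $\lambda$, counted with multiplicity, that are strictly larger than $o(\lambda)$. Put $$\operatorname{rank}(\lambda) = (\text{largest part of }\lambda) - (\text{number of parts of }\lambda),$$ $$\operatorname{crank}(\lambda) = \begin{cases}\text{largest part of }\lambda & \text{if } o(\lambda)=0,\\ \mu(\lambda)-o(\lambda) & \text{if } o(\lambda)>0.\end{cases}$$ Let $N(m,N)$ be the number of partitions of $N$ with rank $m$, and $M(m,N)$ the number of partitions of $N$ with crank $m$, except that for $N=1$ one sets, as usual (in accordance with the crank generating function), $M(\pm1,1)=1$, $M(0,1)=-1$, and $M(m,1)=0$ for $|m|\ge 2$. Define $$\operatorname{ospt}(N) := \sum_{m\ge 1} m\,M(m,N) - \sum_{m\ge 1} m\,N(m,N).$$ Then for every integer $N\ge 1$, $$\operatorname{ospt}(N+1)\ \ge\ \operatorname{ospt}(N).$$ -/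

import Mathlib

namespace PartitionMoments

/-- The largest part of a partition (`0` for the empty partition). -/
def largestPart {N : ℕ} (p : N.Partition) : ℕ := p.parts.sup

/-- Dyson's rank: the largest part minus the number of parts. -/
def rank {N : ℕ} (p : N.Partition) : ℤ :=
  (largestPart p : ℤ) - (p.parts.card : ℤ)

/-- The number of ones in a partition. -/
def numOnes {N : ℕ} (p : N.Partition) : ℕ := p.parts.count 1

/-- The number of parts (with multiplicity) strictly larger than the number of ones. -/
def numAboveOnes {N : ℕ} (p : N.Partition) : ℕ :=
  (p.parts.filter fun a => numOnes p < a).card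

/-- The Andrews-Garvan crank of a partition. -/
def crank {N : ℕ} (p : N.Partition) : ℤ :=
  if numOnes p = 0 then (largestPart p : ℤ)
  else (numAboveOnes p : ℤ) - (numOnes p : ℤ)

/-- `N(m, N)`: the number of partitions of `N` with rank `m`. -/
def rankCount (m : ℤ) (N : ℕ) : ℤ :=
  ((Finset.univ.filter fun p : N.Partition => rank p = m).card : ℤ)

/-- `M(m, N)`: the number of partitions of `N` with crank `m`, except that for `N = 1` it is, as
usual, the coefficient `w⁻¹ - 1 + w` of `q` in the two-variable crank generating function
`∏ (1 - q ^ n) / ((1 - w q ^ n) (1 - w⁻¹ q ^ n))`. -/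
def crankCount (m : ℤ) (N : ℕ) : ℤ :=
  if N = 1 then
    if m = 0 then -1 else if m = 1 ∨ m = -1 then 1 else 0
  else ((Finset.univ.filter fun p : N.Partition => crank p = m).card : ℤ)

/-- The `r`-th positive crank moment `∑_{m ≥ 1} m ^ r M(m, N)`. The terms with `m > N` vanish
(see `crankCount_eq_zero`), so the sum is written as a finite one. -/
def posCrankMoment (r N : ℕ) : ℤ :=
  ∑ m ∈ Finset.Icc 1 N, (m : ℤ) ^ r * crankCount (m : ℤ) N

/-- The `r`-th positive rank moment `∑_{m ≥ 1} m ^ r N(m, N)`. The terms with `m > N` vanish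
(see `rankCount_eq_zero`), so the sum is written as a finite one. -/
def posRankMoment (r N : ℕ) : ℤ :=
  ∑ m ∈ Finset.Icc 1 N, (m : ℤ) ^ r * rankCount (m : ℤ) N

/-- The ospt-function: the first positive crank moment minus the first positive rank moment. -/
def ospt (N : ℕ) : ℤ := posCrankMoment 1 N - posRankMoment 1 N

theorem largestPart_le {N : ℕ} (p : N.Partition) : largestPart p ≤ N :=
  Multiset.sup_le.2 fun _ ha => (Multiset.le_sum_of_mem ha).trans_eq p.parts_sum

theorem card_parts_le {N : ℕ} (p : N.Partition) : p.parts.card ≤ N := by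
  have h := Multiset.card_nsmul_le_sum (s := p.parts) (a := 1) fun a ha => p.parts_pos ha
  simpa [p.parts_sum] using h

theorem rankCount_eq_zero {m N : ℕ} (h : N < m) : rankCount (m : ℤ) N = 0 := by
  have key : ∀ p : N.Partition, rank p ≠ (m : ℤ) := by
    intro p hp
    have h1 := largestPart_le p
    unfold rank at hp
    omega
  simp [rankCount, key]

theorem crankCount_eq_zero {m N : ℕ} (h : N < m) : crankCount (m : ℤ) N = 0 := by
  have key : ∀ p : N.Partition, crank p ≠ (m : ℤ) := by
    intro p hp
    have h1 := largestPart_le p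
    have h2 : numAboveOnes p ≤ N :=
      (Multiset.card_le_card (Multiset.filter_le _ _)).trans (card_parts_le p)
    unfold crank at hp
    split_ifs at hp <;> omega
  unfold crankCount
  by_cases hN : N = 1
  · rw [if_pos hN, if_neg (by omega), if_neg (by omega)]
  · rw [if_neg hN]
    simp [key]

end PartitionMoments

/-! Let p(x) count the partitions of x, with p(x) = 0 for x < 0, and put e(k, m) = k(k-1)/2 + mk
(`crankExp`). The numbers of partitions with crank at least m (identified by `numWith_crankGe`) and
with rank at least m satisfy the recursions `numDiagonal_step` and `numRankGe_step`. Iterating them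
gives ∑ (-1)^k p(N - e), where e = e(k+1, m) for the crank and e = e(k+1, m+k+1) for the rank.
Summing over m ≥ 1, the shift by k+1 telescopes and only m ≤ k+1 survives (`ospt_eq_sum`).

In ospt(N+1) - ospt(N), p is replaced by p(x) - p(x-1), which counts partitions without ones.
Grouping two consecutive k with two consecutive m leaves, after telescoping, coefficients of
(1-q^c)(1-q^d)/∏_{n≥2}(1-q^n) (`ospt_diff_eq_sum`). For distinct c, d ≥ 2 these count partitions
avoiding 1, c, d, so they are nonnegative. When c = 1, d is even and the coefficient is nonnegative
except at q^1, where it is at least -1 (`neg_ite_le_avoidingDiff`). For a given N at most one such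
deficit occurs, and a partition of N - 1 without parts 1, 2, 3 pays for it. -/

namespace PartitionMoments

open Multiset

/-! ### Counting partitions of an integer by a property -/

open scoped Classical in
/-- The partitions of the integer `x`, as multisets of positive natural numbers. -/
noncomputable def partitionsOf (x : ℤ) : Finset (Multiset ℕ) :=
  if x < 0 then ∅ else (Finset.univ : Finset x.toNat.Partition).image fun p => p.parts

theorem mem_partitionsOf {x : ℤ} {s : Multiset ℕ} :
    s ∈ partitionsOf x ↔ (s.sum : ℤ) = x ∧ 0 ∉ s := by
  unfold partitionsOf
  split_ifs with h
  · simp only [Finset.notMem_empty, false_iff]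
    omega
  · simp only [Finset.mem_image, Finset.mem_univ, true_and]
    constructor
    · rintro ⟨p, rfl⟩
      refine ⟨?_, fun h0 => (p.parts_pos h0).ne rfl⟩
      rw [p.parts_sum]; omega
    · rintro ⟨h1, h2⟩
      refine ⟨⟨s, fun {i} hi => Nat.pos_of_ne_zero fun h0 => h2 (h0 ▸ hi), by omega⟩, rfl⟩

open scoped Classical in
/-- The number of partitions of the integer `x` that satisfy `P`. -/
noncomputable def numWith (x : ℤ) (P : Multiset ℕ → Prop) : ℤ :=
  (((partitionsOf x).filter P).card : ℤ)

open scoped Classical in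
theorem numWith_natCast (n : ℕ) (P : Multiset ℕ → Prop) :
    ((Finset.univ.filter fun p : n.Partition => P p.parts).card : ℤ) = numWith n P := by
  unfold numWith
  norm_cast
  refine Finset.card_bij (fun p _ => p.parts) ?_ ?_ ?_
  · intro p hp
    simp only [Finset.mem_filter, Finset.mem_univ, true_and] at hp
    simp only [Finset.mem_filter, mem_partitionsOf]
    exact ⟨⟨by rw [p.parts_sum], fun h0 => (p.parts_pos h0).ne rfl⟩, hp⟩
  · intro p _ q _ h
    exact Nat.Partition.ext h
  · intro s hs
    simp only [Finset.mem_filter, mem_partitionsOf] at hs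
    refine ⟨⟨s, fun {i} hi => Nat.pos_of_ne_zero fun h0 => hs.1.2 (h0 ▸ hi),
      by exact_mod_cast hs.1.1⟩, ?_, rfl⟩
    simpa using hs.2

theorem numWith_nonneg (x : ℤ) (P : Multiset ℕ → Prop) : 0 ≤ numWith x P := by
  unfold numWith; positivity

theorem numWith_congr {x : ℤ} {P Q : Multiset ℕ → Prop}
    (h : ∀ s : Multiset ℕ, (s.sum : ℤ) = x → 0 ∉ s → (P s ↔ Q s)) :
    numWith x P = numWith x Q := by
  classical
  unfold numWith
  have key : (partitionsOf x).filter P = (partitionsOf x).filter Q :=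
    Finset.filter_congr fun s hs => h s (mem_partitionsOf.1 hs).1 (mem_partitionsOf.1 hs).2
  convert congrArg (fun t : Finset (Multiset ℕ) => (t.card : ℤ)) key

theorem numWith_eq_zero {x : ℤ} {P : Multiset ℕ → Prop}
    (h : ∀ s : Multiset ℕ, (s.sum : ℤ) = x → 0 ∉ s → ¬ P s) : numWith x P = 0 := by
  classical
  unfold numWith
  norm_cast
  rw [Finset.card_eq_zero, Finset.filter_eq_empty_iff]
  intro s hs
  rw [mem_partitionsOf] at hs
  exact h s hs.1 hs.2

theorem numWith_of_neg {x : ℤ} (hx : x < 0) (P : Multiset ℕ → Prop) : numWith x P = 0 :=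
  numWith_eq_zero fun s hs => by omega

theorem numWith_pos {x : ℤ} {P : Multiset ℕ → Prop} (s : Multiset ℕ) (hs : (s.sum : ℤ) = x)
    (h0 : 0 ∉ s) (hP : P s) : 1 ≤ numWith x P := by
  unfold numWith
  norm_cast
  exact Finset.card_pos.2 ⟨s, by simp [mem_partitionsOf, hs, h0, hP]⟩

theorem numWith_and_add_and_not (x : ℤ) (P Q : Multiset ℕ → Prop) :
    numWith x (fun s => P s ∧ Q s) + numWith x (fun s => P s ∧ ¬ Q s) = numWith x P := by
  classical
  unfold numWith
  norm_cast
  rw [← Finset.card_filter_add_card_filter_not (s := (partitionsOf x).filter P) Q,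
    Finset.filter_filter, Finset.filter_filter]
  congr!

theorem numWith_add_not (x : ℤ) (Q : Multiset ℕ → Prop) :
    numWith x Q + numWith x (fun s => ¬ Q s) = numWith x fun _ => True := by
  rw [← numWith_and_add_and_not x (fun _ => True) Q]
  simp

theorem sum_numWith {ι : Type*} (t : Finset ι) (x : ℤ) (P : ι → Multiset ℕ → Prop)
    (h : ∀ i j s, P i s → P j s → i = j) :
    ∑ i ∈ t, numWith x (P i) = numWith x fun s => ∃ i ∈ t, P i s := by
  classical
  unfold numWith
  norm_cast
  rw [← Finset.card_biUnion]
  · congr 1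
    ext s
    simp only [Finset.mem_biUnion, Finset.mem_filter]
    tauto
  · intro i _ j _ hij
    refine Finset.disjoint_left.2 fun s hs hs' => hij ?_
    rw [Finset.mem_filter] at hs hs'
    exact h i j s hs.2 hs'.2

theorem numWith_le {x y : ℤ} {P Q : Multiset ℕ → Prop} (f : Multiset ℕ → Multiset ℕ)
    (hf : ∀ s : Multiset ℕ, (s.sum : ℤ) = x → 0 ∉ s → P s →
      ((f s).sum : ℤ) = y ∧ 0 ∉ f s ∧ Q (f s))
    (hinj : ∀ s t : Multiset ℕ, (s.sum : ℤ) = x → (t.sum : ℤ) = x → 0 ∉ s → 0 ∉ t → P s → P t →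
      f s = f t → s = t) :
    numWith x P ≤ numWith y Q := by
  classical
  unfold numWith
  norm_cast
  refine Finset.card_le_card_of_injOn f ?_ ?_
  · intro s hs
    simp only [Finset.coe_filter, mem_partitionsOf, Set.mem_ofPred_eq] at hs ⊢
    have := hf s hs.1.1 hs.1.2 hs.2
    tauto
  · intro s hs t ht hst
    simp only [Finset.coe_filter, mem_partitionsOf, Set.mem_ofPred_eq] at hs ht
    exact hinj s t hs.1.1 ht.1.1 hs.1.2 ht.1.2 hs.2 ht.2 hst

theorem numWith_eq {x y : ℤ} {P Q : Multiset ℕ → Prop} (f g : Multiset ℕ → Multiset ℕ)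
    (hf : ∀ s : Multiset ℕ, (s.sum : ℤ) = x → 0 ∉ s → P s →
      ((f s).sum : ℤ) = y ∧ 0 ∉ f s ∧ Q (f s) ∧ g (f s) = s)
    (hg : ∀ s : Multiset ℕ, (s.sum : ℤ) = y → 0 ∉ s → Q s →
      ((g s).sum : ℤ) = x ∧ 0 ∉ g s ∧ P (g s) ∧ f (g s) = s) :
    numWith x P = numWith y Q := by
  refine le_antisymm (numWith_le f (fun s h1 h2 h3 => ?_) ?_)
    (numWith_le g (fun s h1 h2 h3 => ?_) ?_)
  · have := hf s h1 h2 h3; tauto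
  · intro s t hs ht hs0 ht0 hPs hPt h
    rw [← (hf s hs hs0 hPs).2.2.2, ← (hf t ht ht0 hPt).2.2.2, h]
  · have := hg s h1 h2 h3; tauto
  · intro s t hs ht hs0 ht0 hPs hPt h
    rw [← (hg s hs hs0 hPs).2.2.2, ← (hg t ht ht0 hPt).2.2.2, h]

/-- Adding a part `d` to the partitions of `x - d`. -/
theorem numWith_cons (x : ℤ) {d : ℕ} (hd : 0 < d) (P : Multiset ℕ → Prop) :
    numWith x (fun s => d ∈ s ∧ P (s.erase d)) = numWith (x - d) P := by
  refine numWith_eq (fun s => s.erase d) (fun s => d ::ₘ s) ?_ ?_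
  · rintro s hs h0 ⟨hd, hP⟩
    have h := sum_erase hd
    refine ⟨by omega, fun h => h0 (mem_of_mem_erase h), hP, cons_erase hd⟩
  · intro s hs h0 hP
    refine ⟨by rw [sum_cons]; omega, ?_, ⟨by simp, by simpa using hP⟩, by simp⟩
    simp [h0, hd.ne]

/-! ### Parts above a threshold, and maps that shift them -/

/-- The number of parts that exceed `k`. -/
def numAbove (s : Multiset ℕ) (k : ℕ) : ℕ := (s.filter fun a => k < a).card

theorem numAbove_cons (a : ℕ) (s : Multiset ℕ) (k : ℕ) :
    numAbove (a ::ₘ s) k = numAbove s k + if k < a then 1 else 0 := by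
  unfold numAbove
  rw [filter_cons]
  split_ifs <;> simp [add_comm]

theorem numAbove_anti (s : Multiset ℕ) {j k : ℕ} (h : j ≤ k) : numAbove s k ≤ numAbove s j :=
  card_le_card (monotone_filter_right s fun a (ha : k < a) => h.trans_lt ha)

theorem numAbove_zero {s : Multiset ℕ} (h : 0 ∉ s) : numAbove s 0 = s.card := by
  unfold numAbove
  rw [filter_eq_self.2 fun a ha => Nat.pos_of_ne_zero fun h0 => h (h0 ▸ ha)]

theorem numAbove_eq_succ_add_count (s : Multiset ℕ) (k : ℕ) :
    numAbove s k = numAbove s (k + 1) + s.count (k + 1) := by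
  unfold numAbove
  induction s using Multiset.induction_on with
  | empty => simp
  | cons a s ih =>
    simp only [filter_cons, count_cons, card_add]
    rw [ih]
    split_ifs <;> simp <;> omega

theorem mul_numAbove_le_sum (s : Multiset ℕ) (k : ℕ) : numAbove s k * (k + 1) ≤ s.sum := by
  induction s using Multiset.induction_on with
  | empty => simp [numAbove]
  | cons a s ih =>
    rw [numAbove_cons, sum_cons]
    split_ifs with h
    · rw [add_mul]; omega
    · rw [add_zero]; omega

/-- The strict drop from `k` to `k + 1` on the right forces a part `k + 1`; deleting it lowers
`numAbove s k` by one and keeps `numAbove s (k + 1)`. -/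
theorem numWith_insert_part (y : ℤ) (k M : ℕ) :
    numWith y (fun s => numAbove s (k + 1) ≤ M ∧ M ≤ numAbove s k) =
      numWith (y + (k + 1)) fun s => numAbove s (k + 1) ≤ M ∧ M + 1 ≤ numAbove s k := by
  have h := numWith_cons (y + (k + 1)) k.succ_pos
    fun s => numAbove s (k + 1) ≤ M ∧ M ≤ numAbove s k
  rw [show y + (k + 1) - ((k.succ : ℕ) : ℤ) = y by push_cast; ring] at h
  rw [← h]
  refine numWith_congr fun s _ _ => ?_
  by_cases hk : k + 1 ∈ s
  · obtain ⟨t, rfl⟩ := exists_cons_of_mem hk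
    simp only [Nat.succ_eq_add_one, mem_cons_self, true_and, erase_cons_head, numAbove_cons]
    simp
  · have h1 := numAbove_eq_succ_add_count s k
    rw [count_eq_zero_of_notMem hk] at h1
    simp only [Nat.succ_eq_add_one, hk, false_and, false_iff]
    omega

theorem sum_map_succ (s : Multiset ℕ) : (s.map Nat.succ).sum = s.sum + s.card := by
  induction s using Multiset.induction_on with
  | empty => simp
  | cons a s ih => simp only [map_cons, sum_cons, card_cons, ih]; omega

theorem zero_notMem_replicate_one (n : ℕ) : 0 ∉ replicate n 1 :=
  fun h => zero_ne_one (eq_of_mem_replicate h)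

theorem eq_replicate_add_filter {s : Multiset ℕ} {K : ℕ} (h : ∀ a ∈ s, K ≤ a) :
    s = replicate (s.count K) K + s.filter (K < ·) := by
  rw [← filter_eq']
  conv_lhs => rw [← filter_add_not (fun a => a = K) s]
  congr 1
  refine filter_congr fun a ha => ?_
  have := h a ha
  omega

theorem exists_map_succ_eq {s : Multiset ℕ} {K : ℕ} (h : ∀ a ∈ s, K < a) :
    ∃ t : Multiset ℕ, s = t.map Nat.succ ∧ ∀ a ∈ t, K ≤ a := by
  refine ⟨s.map Nat.pred, ?_, ?_⟩
  · rw [map_map]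
    conv_lhs => rw [← map_id s]
    refine map_congr rfl fun a ha => ?_
    have := h a ha
    simp only [id, Function.comp]
    exact (Nat.succ_pred (by omega)).symm
  · intro a ha
    obtain ⟨b, hb, rfl⟩ := mem_map.1 ha
    exact Nat.le_pred_of_lt (h b hb)

/-- Lower by one all the parts above `K`. -/
def lowerAbove (K : ℕ) (s : Multiset ℕ) : Multiset ℕ :=
  s.filter (· ≤ K) + (s.filter (K < ·)).map Nat.pred

/-- Raise by one the `M` largest parts, when these are all the parts above `K` and some parts
equal to `K`. -/
def raiseLargest (K M : ℕ) (s : Multiset ℕ) : Multiset ℕ :=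
  (s.filter (· ≤ K) - replicate (M - numAbove s K) K) +
    (replicate (M - numAbove s K) K + s.filter (K < ·)).map Nat.succ

theorem lowerAbove_add_map_succ {K : ℕ} {A L : Multiset ℕ} (hA : ∀ a ∈ A, a ≤ K)
    (hL : ∀ a ∈ L, K ≤ a) : lowerAbove K (A + L.map Nat.succ) = A + L := by
  unfold lowerAbove
  rw [filter_add, filter_add, filter_eq_self.2 hA, filter_eq_nil.2, filter_eq_nil.2,
    filter_eq_self.2, add_zero, zero_add, map_map]
  · congr 1
    conv_rhs => rw [← map_id L]
    exact map_congr rfl fun a _ => by simp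
  · intro a ha
    obtain ⟨b, hb, rfl⟩ := mem_map.1 ha
    have := hL b hb; simp only [Nat.succ_eq_add_one]; omega
  · intro a ha; have := hA a ha; omega
  · intro a ha
    obtain ⟨b, hb, rfl⟩ := mem_map.1 ha
    have := hL b hb; simp only [Nat.succ_eq_add_one]; omega

theorem numAbove_add_replicate_add {K r : ℕ} {A B : Multiset ℕ} (hA : ∀ a ∈ A, a ≤ K)
    (hB : ∀ a ∈ B, K < a) : numAbove (A + (replicate r K + B)) K = B.card := by
  unfold numAbove
  rw [filter_add, filter_add, filter_eq_nil.2, filter_eq_nil.2, filter_eq_self.2 hB]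
  · simp
  · intro a ha; rw [eq_of_mem_replicate ha]; omega
  · intro a ha; have := hA a ha; omega

theorem raiseLargest_add {K M r : ℕ} {A B : Multiset ℕ} (hA : ∀ a ∈ A, a ≤ K)
    (hB : ∀ a ∈ B, K < a) (hM : r + B.card = M) :
    raiseLargest K M (A + (replicate r K + B)) = A + (replicate r K + B).map Nat.succ := by
  unfold raiseLargest
  rw [numAbove_add_replicate_add hA hB, show M - B.card = r by omega]
  have h1 : (replicate r K).filter (· ≤ K) = replicate r K :=
    filter_eq_self.2 fun a ha => (eq_of_mem_replicate ha).le
  have h2 : B.filter (· ≤ K) = 0 := filter_eq_nil.2 fun a ha => not_le.2 (hB a ha)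
  have h3 : A.filter (K < ·) = 0 := filter_eq_nil.2 fun a ha => not_lt.2 (hA a ha)
  have h4 : (replicate r K).filter (K < ·) = 0 :=
    filter_eq_nil.2 fun a ha => not_lt.2 (eq_of_mem_replicate ha).le
  simp only [filter_add, filter_eq_self.2 hA, filter_eq_self.2 hB, h1, h2, h3, h4, zero_add,
    add_zero, add_tsub_cancel_right]

/-- Lowering by one the `M` parts above `k + 1`. -/
theorem numWith_numAbove_succ_eq (y : ℤ) (k M : ℕ) :
    numWith (y + M) (fun s => numAbove s (k + 1) = M) =
      numWith y fun s => numAbove s (k + 1) ≤ M ∧ M ≤ numAbove s k := by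
  refine numWith_eq (lowerAbove (k + 1)) (raiseLargest (k + 1) M) ?_ ?_
  · intro s hs h0 hM
    obtain ⟨L, hL, hLK⟩ := exists_map_succ_eq (s := s.filter (k + 1 < ·)) (K := k + 1)
      fun a ha => (mem_filter.1 ha).2
    have hA : ∀ a ∈ s.filter (¬ k + 1 < ·), a ≤ k + 1 := fun a ha => not_lt.1 (mem_filter.1 ha).2
    have hA0 : 0 ∉ s.filter (¬ k + 1 < ·) := fun h => h0 (mem_filter.1 h).1
    have hsum : s = s.filter (¬ k + 1 < ·) + L.map Nat.succ := by
      rw [← hL, add_comm, filter_add_not]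
    have hcard : L.card = M := by
      rw [← hM, numAbove, hL, card_map]
    generalize s.filter (¬ k + 1 < ·) = A at *
    have hL2 := eq_replicate_add_filter hLK
    have hB : ∀ a ∈ L.filter (k + 1 < ·), k + 1 < a := fun a ha => (mem_filter.1 ha).2
    generalize L.count (k + 1) = r at *
    generalize L.filter (k + 1 < ·) = B at *
    clear hL
    subst hsum
    rw [lowerAbove_add_map_succ hA hLK]
    have hc : r + B.card = M := by rw [← hcard, hL2]; simp
    have h1 : numAbove (A + L) (k + 1) = B.card := by
      rw [hL2, numAbove_add_replicate_add hA hB]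
    have h2 := numAbove_eq_succ_add_count (A + L) k
    -- The `r` parts lowered onto `k + 1` lie above `k`, which gives `M ≤ numAbove _ k`.
    have h3 : r ≤ (A + L).count (k + 1) := by
      rw [hL2, count_add, count_add, count_replicate_self]; omega
    refine ⟨?_, ?_, ⟨by omega, by omega⟩, ?_⟩
    · rw [sum_add, sum_map_succ] at hs
      rw [sum_add]; push_cast at hs ⊢; rw [hcard] at hs; linarith
    · rw [mem_add, not_or]
      exact ⟨hA0, fun h => by have := hLK 0 h; omega⟩
    · rw [hL2, raiseLargest_add hA hB hc]
  · rintro s hs h0 ⟨h1, h2⟩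
    have h3 := numAbove_eq_succ_add_count s k
    obtain ⟨r, hr⟩ : ∃ r, r + numAbove s (k + 1) = M := ⟨M - numAbove s (k + 1), by omega⟩
    have hle : replicate r (k + 1) ≤ s.filter (¬ k + 1 < ·) := by
      rw [← le_count_iff_replicate_le, count_filter_of_pos (by omega)]; omega
    obtain ⟨A, hAe⟩ := Multiset.le_iff_exists_add.1 hle
    have hse : s = A + (replicate r (k + 1) + s.filter (k + 1 < ·)) := by
      rw [← add_assoc, add_comm A, ← hAe, add_comm, filter_add_not]
    have hA : ∀ a ∈ A, a ≤ k + 1 := fun a ha => not_lt.1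
      (mem_filter.1 (show a ∈ s.filter (¬ k + 1 < ·) by rw [hAe]; exact mem_add.2 (.inr ha))).2
    have hB : ∀ a ∈ s.filter (k + 1 < ·), k + 1 < a := fun a ha => (mem_filter.1 ha).2
    unfold numAbove at hr
    generalize s.filter (k + 1 < ·) = B at *
    have hL : ∀ a ∈ replicate r (k + 1) + B, k + 1 ≤ a := by
      intro a ha
      rcases mem_add.1 ha with ha | ha
      · rw [eq_of_mem_replicate ha]
      · exact (hB a ha).le
    clear h1 h2 h3 hle hAe
    subst hse
    rw [raiseLargest_add hA hB hr]
    have hcard : (replicate r (k + 1) + B).card = M := by simp [hr]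
    rw [mem_add, not_or] at h0
    generalize replicate r (k + 1) + B = L at *
    refine ⟨?_, ?_, ?_, lowerAbove_add_map_succ hA hL⟩
    · rw [sum_add, sum_map_succ]; rw [sum_add] at hs
      push_cast at hs ⊢; rw [hcard]; linarith
    · rw [mem_add, not_or]
      exact ⟨h0.1, by simp⟩
    · unfold numAbove
      rw [filter_add, filter_eq_nil.2, filter_eq_self.2, zero_add, card_map, hcard]
      · intro a ha
        obtain ⟨b, hb, rfl⟩ := mem_map.1 ha
        have := hL b hb; simp only [Nat.succ_eq_add_one]; omega
      · intro a ha; have := hA a ha; omega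

/-- Lowering by one all the parts, when there are `M` of them. -/
theorem numWith_card_eq (y : ℤ) (M : ℕ) :
    numWith (y + M) (fun s => s.card = M) = numWith y fun s => s.card ≤ M := by
  -- Parts lowered to zero are discarded; the inverse restores them by padding with zeros to `M`
  -- parts.
  refine numWith_eq (fun s => (s.map Nat.pred).filter (0 < ·))
    (fun s => (replicate (M - s.card) 0 + s).map Nat.succ) ?_ ?_
  · intro s hs h0 hM
    obtain ⟨L, rfl, -⟩ := exists_map_succ_eq (s := s) (K := 0)
      fun a ha => Nat.pos_of_ne_zero fun h => h0 (h ▸ ha)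
    have hL : (L.map Nat.succ).map Nat.pred = L := by simp
    have hL2 := eq_replicate_add_filter (s := L) (K := 0) (by simp)
    simp only [hL]
    rw [card_map] at hM
    rw [sum_map_succ] at hs
    have h4 : L.count 0 + (L.filter (0 < ·)).card = M := by
      conv_rhs => rw [← hM, hL2]
      simp
    have h5 : L.sum = (L.filter (0 < ·)).sum := by
      conv_lhs => rw [hL2]
      simp
    refine ⟨by rw [← h5]; push_cast at hs ⊢; rw [hM] at hs; linarith, by simp, by omega, ?_⟩
    rw [show M - (L.filter (0 < ·)).card = L.count 0 by omega, ← hL2]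
  · intro s hs h0 hM
    have hs0 : s.filter (0 < ·) = s :=
      filter_eq_self.2 fun a ha => Nat.pos_of_ne_zero fun h => h0 (h ▸ ha)
    have hL : ((replicate (M - s.card) 0 + s).map Nat.succ).map Nat.pred =
      replicate (M - s.card) 0 + s := by simp
    simp only [hL]
    refine ⟨?_, by simp [zero_notMem_replicate_one], ?_, ?_⟩
    · rw [sum_map_succ, sum_add, sum_replicate, card_add, card_replicate, smul_zero]; omega
    · simp; omega
    · rw [filter_add, hs0, filter_eq_nil.2, zero_add]
      intro a ha; rw [eq_of_mem_replicate ha]; simp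

/-! ### Dyson's recursion for the rank -/

/-- The number of partitions of an integer. -/
noncomputable def numPartitions (x : ℤ) : ℤ := numWith x fun _ => True

/-- The number of partitions of `x` with rank at least `r`. -/
noncomputable def numRankGe (x : ℤ) (r : ℕ) : ℤ := numWith x fun s => s.card + r ≤ s.sup

theorem sup_mem {s : Multiset ℕ} (h : s ≠ 0) : s.sup ∈ s := by
  induction s using Multiset.induction_on with
  | empty => exact absurd rfl h
  | cons a s ih =>
    rw [sup_cons]
    rcases eq_or_ne s 0 with rfl | hs
    · simp
    · rcases le_total a s.sup with h1 | h1
      · rw [sup_eq_right.2 h1]; exact mem_cons_of_mem (ih hs)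
      · rw [sup_eq_left.2 h1]; exact mem_cons_self a s

theorem sup_le_sum (s : Multiset ℕ) : s.sup ≤ s.sum :=
  Multiset.sup_le.2 fun _ ha => le_sum_of_mem ha

/-- Dyson's map: remove the largest part `a` and add one to each of `a - (r + 1)` others, some of
which may be zero. -/
theorem numWith_card_add_le_sup (y : ℤ) (r : ℕ) (hy : 0 ≤ y) :
    numWith (y + (r + 1)) (fun s => s.card + r ≤ s.sup) =
      numWith y fun s => s.sup ≤ s.card + (r + 2) := by
  refine numWith_eq
    (fun s => (s.erase s.sup).map Nat.succ + replicate (s.sup - (s.card + r)) 1)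
    (fun s => (s.card + r + 1) ::ₘ (s.map Nat.pred).filter (0 < ·)) ?_ ?_
  · intro s hs h0 hP
    have hne : s ≠ 0 := by rintro rfl; simp at hs; omega
    obtain ⟨t, ht⟩ := exists_cons_of_mem (sup_mem hne)
    have hsup : ∀ b ∈ t, b ≤ s.sup := fun b hb => le_sup (by rw [ht]; exact mem_cons_of_mem hb)
    generalize s.sup = a at *
    subst ht
    rw [card_cons] at *
    rw [sum_cons] at hs
    rw [mem_cons, not_or] at h0
    have hpos : t.filter (0 < ·) = t :=
      filter_eq_self.2 fun a ha => Nat.pos_of_ne_zero fun h => h0.2 (h ▸ ha)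
    simp only [erase_cons_head]
    refine ⟨?_, by simp [zero_notMem_replicate_one], ?_, ?_⟩
    · rw [sum_add, sum_map_succ, sum_replicate]; simp only [smul_eq_mul]; omega
    · refine Multiset.sup_le.2 fun b hb => ?_
      simp only [card_add, card_map, card_replicate]
      rcases mem_add.1 hb with hb | hb
      · obtain ⟨c, hc, rfl⟩ := mem_map.1 hb
        have := hsup c hc
        simp only [Nat.succ_eq_add_one]; omega
      · rw [eq_of_mem_replicate hb]; omega
    · simp only [card_add, card_map, card_replicate, Multiset.map_add, map_map, filter_add,
        map_replicate]
      congr 1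
      · omega
      · have h1 : (replicate (a - (t.card + 1 + r)) (Nat.pred 1)).filter (0 < ·) = 0 :=
          filter_eq_nil.2 fun b hb => by rw [eq_of_mem_replicate hb]; simp
        rw [h1, add_zero]
        simpa using hpos
  · intro s hs h0 hP
    obtain ⟨L, rfl, -⟩ := exists_map_succ_eq (s := s) (K := 0)
      fun a ha => Nat.pos_of_ne_zero fun h => h0 (h ▸ ha)
    have hL : (L.map Nat.succ).map Nat.pred = L := by simp
    have hL2 := eq_replicate_add_filter (s := L) (K := 0) (by simp)
    simp only [hL]
    have h4 : L.card = L.count 0 + (L.filter (0 < ·)).card := by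
      conv_lhs => rw [hL2]
      simp
    have h5 : L.sum = (L.filter (0 < ·)).sum := by
      conv_lhs => rw [hL2]
      simp
    rw [sum_map_succ] at hs
    rw [card_map] at *
    have hB : (L.filter (0 < ·)).sup ≤ L.card + r + 1 := by
      refine Multiset.sup_le.2 fun b hb => ?_
      have : b + 1 ≤ (L.map Nat.succ).sup :=
        le_sup (mem_map_of_mem Nat.succ (mem_filter.1 hb).1)
      omega
    have hmap : L.map Nat.succ = (L.filter (0 < ·)).map Nat.succ + replicate (L.count 0) 1 := by
      conv_lhs => rw [hL2]
      simp [add_comm]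
    have h00 : 0 ∉ L.filter (0 < ·) := by simp
    rw [hmap]
    generalize L.filter (0 < ·) = B at *
    rw [sup_cons, sup_eq_left.2 hB]
    refine ⟨?_, ?_, ?_, ?_⟩
    · rw [sum_cons]; omega
    · rw [mem_cons, not_or]; exact ⟨by omega, h00⟩
    · rw [card_cons]; omega
    · rw [erase_cons_head, card_cons]
      congr 2
      omega

theorem numRankGe_step (x : ℤ) {r : ℕ} (hr : 1 ≤ r) :
    numRankGe x r = numPartitions (x - (r + 1)) - numRankGe (x - (r + 1)) (r + 3) := by
  rcases lt_or_ge x (r + 1) with hx | hx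
  · unfold numPartitions numRankGe
    rw [numWith_of_neg (x := x - (r + 1)) (by omega), numWith_of_neg (x := x - (r + 1)) (by omega),
      sub_zero]
    -- Rank at least `r ≥ 1` forces a largest part of at least `r + 1`, more than `x`.
    refine numWith_eq_zero fun s hs h0 h => ?_
    rcases eq_or_ne s 0 with rfl | hne
    · simp at h; omega
    · have h1 := sup_le_sum s
      have h2 := card_pos.2 hne
      omega
  · have h := numWith_card_add_le_sup (x - (r + 1)) r (by omega)
    rw [sub_add_cancel] at h
    unfold numPartitions numRankGe
    rw [h, ← numWith_add_not _ fun s => s.card + (r + 3) ≤ s.sup]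
    rw [add_sub_cancel_left]
    exact numWith_congr fun s _ _ => by omega

/-! ### The diagonal count and its recursion -/

/-- The number of partitions of `x` for which, for some `k`, exactly `m + k` parts exceed `k`. -/
noncomputable def numDiagonal (x : ℤ) (m : ℕ) : ℤ :=
  numWith x fun s => ∃ k, numAbove s k = m + k

/-- As `k` grows, `numAbove s k` weakly decreases while `m + k` strictly increases. Starting from `m
≤ numAbove s 0`, they either meet, at a unique `k`, or cross between `k` and `k + 1`. A crossing
forces a part `k + 1`, whose removal gives the `k`-th summand. -/
theorem numWith_le_numAbove_zero (x : ℤ) {m K : ℕ} (hm : 1 ≤ m) (hK : x ≤ K) :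
    numWith x (fun s => m ≤ numAbove s 0) = numDiagonal x m + ∑ k ∈ Finset.range K,
      numWith (x - (k + 1)) fun s => numAbove s (k + 1) ≤ m + k ∧ m + k ≤ numAbove s k := by
  have h1 : ∀ k : ℕ,
      numWith (x - (k + 1)) (fun s => numAbove s (k + 1) ≤ m + k ∧ m + k ≤ numAbove s k) =
        numWith x fun s => numAbove s (k + 1) ≤ m + k ∧ m + k + 1 ≤ numAbove s k := by
    intro k
    rw [numWith_insert_part, sub_add_cancel]
  simp only [h1]
  rw [sum_numWith]
  · rw [← numWith_and_add_and_not x _ fun s => ∃ k, numAbove s k = m + k]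
    congr 1
    · refine numWith_congr fun s _ _ => ⟨fun h => h.2, fun h => ⟨?_, h⟩⟩
      obtain ⟨k, hk⟩ := h
      have := numAbove_anti s (Nat.zero_le k)
      omega
    · refine numWith_congr fun s hs _ => ⟨?_, ?_⟩
      · rintro ⟨h, hne⟩
        -- No part exceeds the sum, so the crossing has happened by `k = s.sum`.
        have hsum : numAbove s s.sum < m + s.sum := by
          have := mul_numAbove_le_sum s s.sum
          have : numAbove s s.sum = 0 := by
            by_contra h0
            have := Nat.mul_le_mul_right (s.sum + 1) (Nat.one_le_iff_ne_zero.2 h0)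
            omega
          omega
        have hex : ∃ d, numAbove s d < m + d := ⟨_, hsum⟩
        classical
        have hd := Nat.find_spec hex
        have hle := Nat.find_min' hex hsum
        have hmin := fun e => Nat.find_min hex (m := e)
        generalize Nat.find hex = d at *
        obtain _ | k := d
        · omega
        · have h2 := hmin k (by omega)
          refine ⟨k, Finset.mem_range.2 (by omega), by omega, ?_⟩
          have : numAbove s k ≠ m + k := fun h => hne ⟨k, h⟩
          omega
      · rintro ⟨k, -, h2, h3⟩
        have h0 := numAbove_anti s (Nat.zero_le k)
        refine ⟨by omega, ?_⟩
        rintro ⟨j, hj⟩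
        rcases le_or_gt j k with hjk | hjk
        · have := numAbove_anti s hjk
          omega
        · have := numAbove_anti s (Nat.succ_le_of_lt hjk)
          simp only [Nat.succ_eq_add_one] at this
          omega
  · rintro i j s ⟨h2, h3⟩ ⟨h4, h5⟩
    rcases lt_trichotomy i j with h | h | h
    · have := numAbove_anti s (Nat.succ_le_of_lt h)
      simp only [Nat.succ_eq_add_one] at this
      omega
    · exact h
    · have := numAbove_anti s (Nat.succ_le_of_lt h)
      simp only [Nat.succ_eq_add_one] at this
      omega

/-- Lower the `m + k` parts above `k`. A meeting at `0` becomes a partition of `x - m` with at most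
`m` parts; a meeting at `k + 1` becomes a crossing at `k` for `m + 1`, with its part `k + 1`
deleted. Such crossings and the meetings for `m + 1` together exhaust the partitions of `x - m` with
more than `m` parts. -/
theorem numDiagonal_step (x : ℤ) (m : ℕ) :
    numDiagonal x m = numPartitions (x - m) - numDiagonal (x - m) (m + 1) := by
  obtain ⟨y, rfl⟩ : ∃ y, x = y + m := ⟨x - m, by ring⟩
  rw [add_sub_cancel_right]
  have h := numWith_le_numAbove_zero y (m := m + 1) (K := y.toNat) (by omega) (by omega)
  have h1 : ∀ k : ℕ, numWith (y - (k + 1))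
      (fun s => numAbove s (k + 1) ≤ m + 1 + k ∧ m + 1 + k ≤ numAbove s k) =
        numWith (y + m) fun s => numAbove s (k + 1) = m + (k + 1) := by
    intro k
    rw [← numWith_numAbove_succ_eq]
    rw [show y - (k + 1) + ((m + 1 + k : ℕ) : ℤ) = y + m by push_cast; ring]
    exact numWith_congr fun s _ _ => by omega
  simp only [h1] at h
  have h2 : numWith y (fun s => ¬ m + 1 ≤ numAbove s 0) =
      numWith (y + m) fun s => numAbove s 0 = m + 0 := by
    rw [numWith_congr (Q := fun s => s.card ≤ m), ← numWith_card_eq]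
    · exact numWith_congr fun s _ h0 => by rw [numAbove_zero h0, add_zero]
    · intro s _ h0
      rw [numAbove_zero h0]; omega
  have h3 := numWith_add_not y fun s => m + 1 ≤ numAbove s 0
  have h4 : numDiagonal (y + m) m = ∑ k ∈ Finset.range (y.toNat + 1),
      numWith (y + m) fun s => numAbove s k = m + k := by
    rw [sum_numWith]
    · refine numWith_congr fun s hs _ => ⟨?_, fun ⟨k, _, h⟩ => ⟨k, h⟩⟩
      rintro ⟨k, hk⟩
      refine ⟨k, Finset.mem_range.2 ?_, hk⟩
      have h5 := mul_numAbove_le_sum s k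
      rw [hk] at h5
      have h6 : m + k ≤ s.sum := by nlinarith
      have h7 : (k : ℤ) ≤ y := by
        replace h5 := Int.ofNat_le.2 h5
        rw [hs] at h5
        push_cast at h5
        nlinarith [mul_nonneg (Int.natCast_nonneg m) (Int.natCast_nonneg k),
          mul_nonneg (Int.natCast_nonneg k) (Int.natCast_nonneg k)]
      omega
    · intro i j s hi hj
      rcases le_total i j with h | h <;> have := numAbove_anti s h <;> omega
  rw [Finset.sum_range_succ'] at h4
  unfold numPartitions
  linarith

/-! ### Conjugation, and the crank as a diagonal count -/

theorem numWith_and_one_notMem (x : ℤ) (Q : Multiset ℕ → Prop) (hQ : ∀ s, Q (1 ::ₘ s) ↔ Q s) :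
    numWith x (fun s => Q s ∧ 1 ∉ s) = numWith x Q - numWith (x - 1) Q := by
  rw [← numWith_and_add_and_not x Q fun s => 1 ∈ s]
  have h := numWith_cons x one_pos Q
  rw [Nat.cast_one] at h
  rw [← h, eq_sub_iff_add_eq, add_comm]
  congr 1
  refine numWith_congr fun s _ _ => ?_
  rw [and_comm]
  refine and_congr_left fun h1 => ?_
  rw [← hQ, cons_erase h1]

theorem numWith_count_one_eq (y : ℤ) (K : ℕ) (Q : Multiset ℕ → Prop)
    (hQ : ∀ s, Q (1 ::ₘ s) ↔ Q s) :
    numWith (y + K) (fun s => s.count 1 = K ∧ Q s) = numWith y fun s => Q s ∧ 1 ∉ s := by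
  induction K with
  | zero =>
    rw [Nat.cast_zero, add_zero]
    exact numWith_congr fun s _ _ => by rw [count_eq_zero, and_comm]
  | succ K ih =>
    rw [← ih, show y + K = y + (K + 1 : ℕ) - (1 : ℕ) by push_cast; ring, ← numWith_cons _ one_pos]
    refine numWith_congr fun s _ _ => ?_
    by_cases h : 1 ∈ s
    · obtain ⟨t, rfl⟩ := exists_cons_of_mem h
      simp [hQ]
    · simp [h]

/-- Conjugation without diagrams: both counts obey one recursion, from deleting a part `m + 1` on
one side and lowering all `m + 1` parts on the other. -/
theorem numWith_sup_le (m : ℕ) (x : ℤ) :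
    numWith x (fun s => s.sup ≤ m) = numWith x fun s => s.card ≤ m := by
  induction m generalizing x with
  | zero =>
    refine numWith_congr fun s _ h0 => ?_
    rw [Nat.le_zero, Nat.le_zero, card_eq_zero]
    refine ⟨fun h => ?_, fun h => by rw [h]; rfl⟩
    by_contra hne
    exact h0 (h ▸ sup_mem hne)
  | succ m ih =>
    suffices ∀ n : ℕ, ∀ x : ℤ, x < n →
        numWith x (fun s => s.sup ≤ m + 1) = numWith x fun s => s.card ≤ m + 1 from
      this (x.toNat + 1) x (by omega)
    intro n
    induction n with
    | zero => intro x hx; rw [numWith_of_neg (by omega), numWith_of_neg (by omega)]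
    | succ n ihn =>
      intro x hx
      rw [← numWith_and_add_and_not x (fun s => s.sup ≤ m + 1) fun s => m + 1 ∈ s,
        ← numWith_and_add_and_not x (fun s => s.card ≤ m + 1) fun s => s.card = m + 1]
      congr 1
      · have h1 := numWith_cons x m.succ_pos fun s => s.sup ≤ m + 1
        have h2 := numWith_card_eq (x - (m + 1 : ℕ)) (m + 1)
        rw [sub_add_cancel] at h2
        have h3 := ihn (x - (m + 1 : ℕ)) (by push_cast; omega)
        calc _ = _ := numWith_congr fun s _ _ => ?_
          _ = _ := h1
          _ = _ := h3
          _ = _ := h2.symm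
          _ = _ := numWith_congr fun s _ _ => by omega
        rw [and_comm]
        refine and_congr_right fun h => ?_
        conv_lhs => rw [← cons_erase h, sup_cons]
        simp
      · calc _ = _ := numWith_congr fun s _ _ => ?_
          _ = _ := ih x
          _ = _ := numWith_congr fun s _ _ => by omega
        refine ⟨fun h => ?_, fun h => ⟨h.trans m.le_succ, fun hm => ?_⟩⟩
        · rcases eq_or_ne s 0 with rfl | hne
          · simp
          · have h4 := sup_mem hne
            have : s.sup ≠ m + 1 := fun h5 => h.2 (h5 ▸ h4)
            omega
        · have := le_sup hm
          omega

theorem numWith_le_sup (m : ℕ) (x : ℤ) :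
    numWith x (fun s => m ≤ s.sup) = numWith x fun s => m ≤ numAbove s 0 := by
  rw [numWith_congr (P := fun s => m ≤ numAbove s 0) (Q := fun s => m ≤ s.card)
    fun s _ h0 => by rw [numAbove_zero h0]]
  obtain _ | m := m
  · simp
  · have h1 := numWith_add_not x fun s => s.sup ≤ m
    have h2 := numWith_add_not x fun s => s.card ≤ m
    rw [numWith_sup_le] at h1
    simp only [not_le, ← Nat.succ_le_iff, Nat.succ_eq_add_one] at h1 h2
    linarith

/-- The crank is at least `m`, as a property of the multiset of parts. -/
def CrankGe (m : ℕ) (s : Multiset ℕ) : Prop :=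
  (1 ∉ s ∧ m ≤ s.sup) ∨ (1 ∈ s ∧ m + s.count 1 ≤ numAbove s (s.count 1))

/-- Summand `k` treats exactly `k + 1` ones: strip them, and count what has no ones left as a
difference. -/
theorem numWith_crankGe_and_one_mem (n m : ℕ) :
    numWith n (fun s => CrankGe m s ∧ 1 ∈ s) = ∑ k ∈ Finset.range n,
      (numWith (n - (k + 1)) (fun s => m + (k + 1) ≤ numAbove s (k + 1)) -
        numWith (n - (k + 1) - 1) fun s => m + (k + 1) ≤ numAbove s (k + 1)) := by
  have hQ : ∀ (k : ℕ) (s : Multiset ℕ), m + (k + 1) ≤ numAbove (1 ::ₘ s) (k + 1) ↔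
      m + (k + 1) ≤ numAbove s (k + 1) := by
    intro k s
    rw [numAbove_cons, if_neg (by omega), add_zero]
  have h1 : ∀ k : ℕ, numWith (n - (k + 1)) (fun s => m + (k + 1) ≤ numAbove s (k + 1)) -
      numWith (n - (k + 1) - 1) (fun s => m + (k + 1) ≤ numAbove s (k + 1)) =
        numWith n fun s => s.count 1 = k + 1 ∧ m + (k + 1) ≤ numAbove s (k + 1) := by
    intro k
    rw [← numWith_and_one_notMem _ _ (hQ k), ← numWith_count_one_eq _ (k + 1) _ (hQ k)]
    push_cast
    rw [sub_add_cancel]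
  simp only [h1]
  rw [sum_numWith]
  · refine numWith_congr fun s hs _ => ?_
    constructor
    · rintro ⟨h1 | h1, h2⟩
      · exact absurd h2 h1.1
      · have h3 := count_pos.2 h2
        have h4 : s.count 1 ≤ s.sum := by
          have h5 := Multiset.le_iff_exists_add.1 (le_count_iff_replicate_le.1 (le_refl (s.count 1)))
          obtain ⟨t, ht⟩ := h5
          conv_rhs => rw [ht]
          simp
        refine ⟨s.count 1 - 1, Finset.mem_range.2 (by omega), by omega, ?_⟩
        rw [Nat.sub_add_cancel h3]
        exact h1.2
    · rintro ⟨k, -, h1, h2⟩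
      have h3 : 1 ∈ s := count_pos.1 (by omega)
      exact ⟨.inr ⟨h3, by rwa [h1]⟩, h3⟩
  · rintro i j s ⟨hi, -⟩ ⟨hj, -⟩
    omega

theorem numWith_crankGe_and_one_notMem {n : ℕ} (hn : 2 ≤ n) (m : ℕ) :
    numWith n (fun s => CrankGe m s ∧ 1 ∉ s) =
      numWith n (fun s => m ≤ numAbove s 0) - numWith (n - 1) fun s => m ≤ numAbove s 0 := by
  -- `m ≤ s.sup` can change when a one is added to the empty partition; `m ≤ (1 ::ₘ s).sup` cannot,
  -- and agrees with it for nonempty `s`.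
  have h1 : ∀ x : ℤ, 1 ≤ x →
      numWith x (fun s => m ≤ (1 ::ₘ s).sup) = numWith x fun s => m ≤ numAbove s 0 := by
    intro x hx
    rw [← numWith_le_sup]
    refine numWith_congr fun s hs h0 => ?_
    have hne : s ≠ 0 := by rintro rfl; simp at hs; omega
    have h2 : 1 ≤ s.sup := Nat.one_le_iff_ne_zero.2 fun h => h0 (h ▸ sup_mem hne)
    rw [sup_cons, sup_eq_right.2 h2]
  rw [← h1 n (by omega), ← h1 (n - 1) (by omega), ← numWith_and_one_notMem]
  · refine numWith_congr fun s hs h0 => and_congr_left fun h => ?_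
    have hne : s ≠ 0 := by rintro rfl; simp at hs; omega
    have h2 : 1 ≤ s.sup := Nat.one_le_iff_ne_zero.2 fun h => h0 (h ▸ sup_mem hne)
    rw [sup_cons, sup_eq_right.2 h2]
    simp [CrankGe, h]
  · intro s
    simp

/-- Sorting by the number of ones and the meet-or-cross decomposition both yield sums of counts of
`m + k ≤ numAbove s k`; they differ by a telescoping sum. -/
theorem numWith_crankGe {n m : ℕ} (hn : 2 ≤ n) (hm : 1 ≤ m) :
    numWith n (CrankGe m) = numDiagonal n m := by
  have h := numWith_le_numAbove_zero n (K := n) hm le_rfl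
  have h1 := numWith_and_add_and_not n (CrankGe m) fun s => 1 ∈ s
  rw [numWith_crankGe_and_one_mem, numWith_crankGe_and_one_notMem hn] at h1
  have h2 : ∀ k : ℕ, numWith (n - (k + 1))
      (fun s => numAbove s (k + 1) ≤ m + k ∧ m + k ≤ numAbove s k) =
        numWith (n - (k + 1)) (fun s => m + k ≤ numAbove s k) -
        numWith (n - (k + 1)) (fun s => m + (k + 1) ≤ numAbove s (k + 1)) := by
    intro k
    rw [← numWith_and_add_and_not _ (fun s => m + k ≤ numAbove s k)
      fun s => m + (k + 1) ≤ numAbove s (k + 1), eq_sub_iff_add_eq, add_comm]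
    congr 1
    · refine numWith_congr fun s _ _ => ?_
      have := numAbove_anti s k.le_succ
      simp only [Nat.succ_eq_add_one] at this
      omega
    · exact numWith_congr fun s _ _ => by omega
  simp only [h2] at h
  have h3 := Finset.sum_range_sub
    (fun k : ℕ => numWith ((n : ℤ) - k - 1) (fun s => m + k ≤ numAbove s k)) n
  rw [sub_self, numWith_of_neg (by norm_num)] at h3
  simp only [Finset.sum_sub_distrib] at h h1 h3
  simp only [Nat.cast_add, Nat.cast_one, Nat.cast_zero, sub_zero, add_zero] at h3
  have h4 : ∀ k : ℕ, (n : ℤ) - k - 1 = n - (k + 1) := fun k => by ring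
  simp only [h4] at h3
  linarith

/-! ### Iterating the recursions into alternating sums -/

/-- The triangular number `k (k - 1) / 2`. -/
def triangular : ℕ → ℤ
  | 0 => 0
  | k + 1 => triangular k + k

theorem two_mul_triangular (k : ℕ) : 2 * triangular k = k * (k - 1) := by
  induction k with
  | zero => simp [triangular]
  | succ k ih => rw [triangular, mul_add, ih]; push_cast; ring

theorem triangular_nonneg (k : ℕ) : 0 ≤ triangular k := by
  induction k with
  | zero => simp [triangular]
  | succ k ih => rw [triangular]; positivity

theorem iterate_alternating {H : ℤ → ℕ → ℤ} {p : ℤ → ℤ} (c d : ℕ)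
    (hH : ∀ x r, 1 ≤ r → H x r = p (x - (r + c)) - H (x - (r + c)) (r + d)) (x : ℤ) {r : ℕ}
    (hr : 1 ≤ r) (K : ℕ) :
    H x r = ∑ k ∈ Finset.range K,
      (-1) ^ k * p (x - ((k + 1) * (r + c) + d * triangular (k + 1))) +
        (-1) ^ K * H (x - (K * (r + c) + d * triangular K)) (r + K * d) := by
  induction K with
  | zero => simp [triangular]
  | succ K ih =>
    rw [ih, Finset.sum_range_succ, hH _ (r + K * d) (by omega)]
    have h1 : x - (K * (r + c) + d * triangular K) - ((r + K * d : ℕ) + c) =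
        x - ((K + 1) * (r + c) + d * triangular (K + 1)) := by
      rw [triangular]; push_cast; ring
    have h2 : r + K * d + d = r + (K + 1) * d := by ring
    rw [h1, h2]
    push_cast
    ring

theorem eq_alternating_sum {H : ℤ → ℕ → ℤ} {p : ℤ → ℤ} (c d : ℕ)
    (hH : ∀ x r, 1 ≤ r → H x r = p (x - (r + c)) - H (x - (r + c)) (r + d))
    (hneg : ∀ x r, x < 0 → H x r = 0) {x : ℤ} {r K : ℕ} (hr : 1 ≤ r) (hK : x < K) :
    H x r = ∑ k ∈ Finset.range K,
      (-1) ^ k * p (x - ((k + 1) * (r + c) + d * triangular (k + 1))) := by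
  rw [iterate_alternating c d hH x hr K, hneg, mul_zero, add_zero]
  have h1 := mul_nonneg (Int.natCast_nonneg d) (triangular_nonneg K)
  have h2 : (K : ℤ) * 1 ≤ K * (r + c) :=
    mul_le_mul_of_nonneg_left (by omega) (Int.natCast_nonneg K)
  linarith

/-- The exponent `k (k - 1) / 2 + m k`. -/
def crankExp (k m : ℕ) : ℤ := triangular k + m * k

theorem le_crankExp_succ (k m : ℕ) : (m : ℤ) ≤ crankExp (k + 1) m := by
  unfold crankExp
  have := triangular_nonneg (k + 1)
  have := mul_nonneg (Int.natCast_nonneg m) (Int.natCast_nonneg k)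
  push_cast
  linarith

theorem numDiagonal_eq_sum {x : ℤ} {m K : ℕ} (hm : 1 ≤ m) (hK : x < K) :
    numDiagonal x m = ∑ k ∈ Finset.range K,
      (-1) ^ k * numPartitions (x - crankExp (k + 1) m) := by
  rw [eq_alternating_sum (H := numDiagonal) (p := numPartitions) 0 1 (fun x r _ => by
    rw [numDiagonal_step x r, Nat.cast_zero, add_zero]) (fun x r hx => numWith_of_neg hx _) hm hK]
  refine Finset.sum_congr rfl fun k _ => ?_
  congr 2
  unfold crankExp
  push_cast
  ring

/-- The exponent (k+1)(m+1) + 3·`triangular (k + 1)` is the crank exponent at m + k + 1, because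
2·`triangular (k + 1)` = k(k+1). -/
theorem numRankGe_eq_sum {x : ℤ} {m K : ℕ} (hm : 1 ≤ m) (hK : x < K) :
    numRankGe x m = ∑ k ∈ Finset.range K,
      (-1) ^ k * numPartitions (x - crankExp (k + 1) (m + (k + 1))) := by
  rw [eq_alternating_sum (H := numRankGe) (p := numPartitions) 1 3 (fun x r hr => by
    rw [numRankGe_step x hr, Nat.cast_one]) (fun x r hx => numWith_of_neg hx _) hm hK]
  refine Finset.sum_congr rfl fun k _ => ?_
  congr 2
  have h := two_mul_triangular (k + 1)
  unfold crankExp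
  push_cast at h ⊢
  linear_combination -h

/-! ### The first moments and ospt -/

/-- Abel summation, turning a first moment into a sum of tail counts. -/
theorem sum_mul_sub (S : ℕ → ℤ) (n : ℕ) :
    ∑ m ∈ Finset.Icc 1 n, (m : ℤ) ^ 1 * (S m - S (m + 1)) =
      ∑ m ∈ Finset.range n, S (m + 1) - n * S (n + 1) := by
  induction n with
  | zero => simp
  | succ n ih =>
    rw [Finset.sum_Icc_succ_top (by omega), ih, Finset.sum_range_succ]
    push_cast
    ring

theorem rankCount_eq_sub (m N : ℕ) :
    rankCount m N = numRankGe N m - numRankGe N (m + 1) := by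
  unfold rankCount numRankGe
  rw [← numWith_and_add_and_not N _ fun s => s.card + (m + 1) ≤ s.sup, eq_sub_iff_add_eq, add_comm]
  have h := numWith_natCast N fun s : Multiset ℕ => s.sup = s.card + m
  congr 1
  · exact numWith_congr fun s _ _ => by omega
  · rw [← numWith_congr (P := fun s : Multiset ℕ => s.sup = s.card + m) fun s _ _ => by omega, ← h]
    congr 2
    ext p
    simp only [Finset.mem_filter, Finset.mem_univ, true_and]
    unfold rank largestPart
    omega

theorem posRankMoment_one (N : ℕ) :
    posRankMoment 1 N = ∑ m ∈ Finset.range N, numRankGe N (m + 1) := by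
  unfold posRankMoment
  simp only [rankCount_eq_sub]
  rw [sum_mul_sub fun m => numRankGe N m]
  have h : numRankGe N (N + 1) = 0 := numWith_eq_zero fun s hs _ h => by
    have := sup_le_sum s
    omega
  rw [h, mul_zero, sub_zero]

theorem crankGe_parts_iff {N m : ℕ} (p : N.Partition) : CrankGe m p.parts ↔ (m : ℤ) ≤ crank p := by
  unfold CrankGe crank numAboveOnes numOnes largestPart numAbove
  rw [← count_eq_zero, ← Multiset.one_le_count_iff_mem]
  split_ifs with h
  · simp [h]
  · simp only [h, false_and, false_or]
    omega

theorem crankCount_eq_sub {N : ℕ} (hN : 2 ≤ N) {m : ℕ} (hm : 1 ≤ m) :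
    crankCount m N = numDiagonal N m - numDiagonal N (m + 1) := by
  unfold crankCount
  rw [if_neg (by omega), ← numWith_crankGe hN hm, ← numWith_crankGe hN (m.le_succ.trans' hm),
    ← numWith_and_add_and_not N (CrankGe m) (CrankGe m.succ), ← numWith_natCast, ← numWith_natCast,
    ← numWith_natCast, eq_sub_iff_add_eq, add_comm]
  congr 3
  · ext p
    simp only [Finset.mem_filter, Finset.mem_univ, true_and, crankGe_parts_iff]
    push_cast
    omega
  · ext p
    simp only [Finset.mem_filter, Finset.mem_univ, true_and, crankGe_parts_iff]
    push_cast
    omega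

theorem posCrankMoment_one {N : ℕ} (hN : 1 ≤ N) :
    posCrankMoment 1 N = ∑ m ∈ Finset.range N, numDiagonal N (m + 1) := by
  -- At `N = 1` the conventional crank counts apply, so this case is computed directly.
  rcases hN.eq_or_lt with rfl | hN
  · have h : numDiagonal 1 1 = 1 := by
      rw [numDiagonal_step, Nat.cast_one, sub_self]
      have h1 : numDiagonal 0 (1 + 1) = 0 := by
        rw [numDiagonal_step, numDiagonal, numPartitions, numWith_of_neg (by norm_num),
          numWith_of_neg (by norm_num), sub_zero]
      have h2 : numPartitions 0 = 1 := by
        rw [numPartitions, ← Nat.cast_zero, ← numWith_natCast]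
        simp
      rw [h1, h2, sub_zero]
    simp [posCrankMoment, crankCount, h]
  · unfold posCrankMoment
    rw [Finset.sum_congr rfl fun m hm => by
      rw [crankCount_eq_sub hN (Finset.mem_Icc.1 hm).1], sum_mul_sub fun m => numDiagonal N m]
    have h : numDiagonal N (N + 1) = 0 := numWith_eq_zero fun s hs _ ⟨k, h⟩ => by
      have h1 := mul_numAbove_le_sum s k
      have h2 := Nat.le_mul_of_pos_right (numAbove s k) k.succ_pos
      simp only [Nat.succ_eq_add_one] at h2
      omega
    rw [h, mul_zero, sub_zero]

theorem sum_range_sub_shift (f : ℕ → ℤ) (N j : ℕ) :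
    ∑ m ∈ Finset.range N, (f m - f (m + j)) =
      ∑ m ∈ Finset.range j, f m - ∑ m ∈ Finset.range j, f (N + m) := by
  have h1 := Finset.sum_range_add f N j
  have h2 := Finset.sum_range_add f j N
  rw [add_comm j N] at h2
  simp only [add_comm j] at h2
  rw [Finset.sum_sub_distrib]
  linarith

/-- The rank term at `m` is the crank term at `m + k + 1`, so the sum over `m` telescopes to its
first `k + 1` terms; those at the far end have exponents above `N`. -/
theorem ospt_eq_sum {N K : ℕ} (hN : 1 ≤ N) (hK : N < K) :
    ospt N = ∑ k ∈ Finset.range K, (-1) ^ k * ∑ m ∈ Finset.range (k + 1),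
      numPartitions (N - crankExp (k + 1) (m + 1)) := by
  unfold ospt
  rw [posCrankMoment_one hN, posRankMoment_one, ← Finset.sum_sub_distrib]
  rw [Finset.sum_congr rfl fun m _ => by
    rw [numDiagonal_eq_sum (Nat.succ_pos m) (by exact_mod_cast hK),
      numRankGe_eq_sum (Nat.succ_pos m) (by exact_mod_cast hK), ← Finset.sum_sub_distrib],
    Finset.sum_comm]
  refine Finset.sum_congr rfl fun k _ => ?_
  simp only [← mul_sub]
  rw [← Finset.mul_sum]
  congr 1
  have h := sum_range_sub_shift (fun m => numPartitions (N - crankExp (k + 1) (m + 1))) N (k + 1)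
  have h0 : ∑ m ∈ Finset.range (k + 1), numPartitions (N - crankExp (k + 1) (N + m + 1)) = 0 :=
    Finset.sum_eq_zero fun m _ => numWith_of_neg (by
      have := le_crankExp_succ k (N + m + 1)
      push_cast at this
      omega) _
  simp only [h0, sub_zero] at h
  rw [← h]
  refine Finset.sum_congr rfl fun m _ => ?_
  rw [show m + 1 + (k + 1) = m + (k + 1) + 1 by ring]

/-! ### Partitions avoiding given parts -/

/-- The number of partitions of `x` with no part in `S`. -/
noncomputable def numAvoiding (x : ℤ) (S : Finset ℕ) : ℤ := numWith x fun s => ∀ d ∈ S, d ∉ s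

theorem numAvoiding_of_neg {x : ℤ} (hx : x < 0) (S : Finset ℕ) : numAvoiding x S = 0 :=
  numWith_of_neg hx _

theorem numAvoiding_empty (x : ℤ) : numAvoiding x ∅ = numPartitions x :=
  numWith_congr fun s _ _ => by simp

theorem numAvoiding_insert (x : ℤ) {S : Finset ℕ} {d : ℕ} (hd : 0 < d) (hS : d ∉ S) :
    numAvoiding x (insert d S) = numAvoiding x S - numAvoiding (x - d) S := by
  unfold numAvoiding
  rw [← numWith_cons x hd, ← numWith_and_add_and_not x (fun s => ∀ c ∈ S, c ∉ s) fun s => d ∈ s,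
    eq_sub_iff_add_eq, add_comm]
  congr 1
  · refine numWith_congr fun s _ _ => ?_
    rw [and_comm]
    refine and_congr_left fun _ => forall₂_congr fun c hc => ?_
    rw [mem_erase_of_ne]
    rintro rfl
    exact hS hc
  · refine numWith_congr fun s _ _ => ?_
    rw [Finset.forall_mem_insert, and_comm]

theorem numPartitions_sub (x : ℤ) :
    numPartitions x - numPartitions (x - 1) = numAvoiding x {1} := by
  have h := numAvoiding_insert x one_pos (Finset.notMem_empty 1)
  rw [numAvoiding_empty, numAvoiding_empty] at h
  exact h.symm

/-- The coefficient of `q ^ x` in `(1 - q ^ c) (1 - q ^ d) / ∏_{n ≥ 2} (1 - q ^ n)`. -/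
noncomputable def avoidingDiff (x : ℤ) (c d : ℕ) : ℤ :=
  numAvoiding x {1} - numAvoiding (x - c) {1} - numAvoiding (x - d) {1} +
    numAvoiding (x - c - d) {1}

theorem avoidingDiff_eq (x : ℤ) {c d : ℕ} (hc : 2 ≤ c) (hd : 2 ≤ d) (hcd : c ≠ d) :
    avoidingDiff x c d = numAvoiding x {d, c, 1} := by
  rw [numAvoiding_insert x (by omega) (by simp; omega),
    numAvoiding_insert x (by omega) (by simp; omega),
    numAvoiding_insert (x - d) (by omega) (by simp; omega), avoidingDiff,
    show x - d - c = x - c - d by ring]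
  ring

theorem avoidingDiff_nonneg (x : ℤ) {c d : ℕ} (hc : 2 ≤ c) (hd : 2 ≤ d) (hcd : c ≠ d) :
    0 ≤ avoidingDiff x c d := by
  rw [avoidingDiff_eq x hc hd hcd]
  exact numWith_nonneg _ _

theorem numAvoiding_sub_two (x : ℤ) :
    numAvoiding x {2, 1} = numAvoiding x {1} - numAvoiding (x - 2) {1} :=
  numAvoiding_insert x two_pos (by simp)

theorem three_le_of_mem {s : Multiset ℕ} (h0 : 0 ∉ s) (h : ∀ d ∈ ({2, 1} : Finset ℕ), d ∉ s)
    {a : ℕ} (ha : a ∈ s) : 3 ≤ a := by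
  by_contra hlt
  have h1 : 1 ∉ s := h 1 (by simp)
  have h2 : 2 ∉ s := h 2 (by simp)
  interval_cases a <;> contradiction

/-- Raise a largest part by one; it stays the largest, so the map is injective. At `x = 1` the empty
partition has no part to raise. -/
theorem numAvoiding_mono {x : ℤ} (hx : x ≠ 1) :
    numAvoiding (x - 1) {2, 1} ≤ numAvoiding x {2, 1} := by
  rcases lt_or_gt_of_ne hx with hx | hx
  · rw [numAvoiding_of_neg (by omega)]
    exact numWith_nonneg _ _
  · refine numWith_le (fun s => (s.sup + 1) ::ₘ s.erase s.sup) ?_ ?_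
    · intro s hs h0 h
      have hne : s ≠ 0 := by rintro rfl; simp at hs; omega
      have h1 := sup_mem hne
      have h2 := sum_erase h1
      have h3 : ∀ a ∈ (s.sup + 1) ::ₘ s.erase s.sup, 3 ≤ a := by
        intro a ha
        rcases mem_cons.1 ha with rfl | ha
        · have := three_le_of_mem h0 h h1
          omega
        · exact three_le_of_mem h0 h (mem_of_mem_erase ha)
      refine ⟨by rw [sum_cons]; omega, fun h => by have := h3 _ h; omega, fun d hd hd' => ?_⟩
      have := h3 d hd'
      simp only [Finset.mem_insert, Finset.mem_singleton] at hd
      omega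
    · intro s t hs ht _ _ _ _ hst
      have hsne : s ≠ 0 := by rintro rfl; simp at hs; omega
      have htne : t ≠ 0 := by rintro rfl; simp at ht; omega
      have hsup : ∀ u : Multiset ℕ, ((u.sup + 1) ::ₘ u.erase u.sup).sup = u.sup + 1 := by
        intro u
        rw [sup_cons, sup_eq_left]
        exact (sup_mono (erase_subset _ _)).trans (Nat.le_succ _)
      have h := congrArg sup hst
      rw [hsup, hsup] at h
      have h' : s.sup = t.sup := by omega
      rw [← cons_erase (sup_mem hsne), ← cons_erase (sup_mem htne), ← h']
      rw [← h'] at hst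
      rw [(cons_inj_right _).1 hst]

theorem numAvoiding_zero : numAvoiding 0 {2, 1} = 1 := by
  rw [numAvoiding_sub_two, ← numPartitions_sub, numAvoiding_of_neg (x := 0 - 2) (by norm_num),
    numPartitions, numPartitions, numWith_of_neg (x := 0 - 1) (by norm_num), ← Nat.cast_zero,
    ← numWith_natCast]
  simp

theorem numAvoiding_two_lt_three : numAvoiding 2 {2, 1} + 1 ≤ numAvoiding 3 {2, 1} := by
  have h : numAvoiding 2 {2, 1} = 0 := numWith_eq_zero fun s hs h0 h => by
    have hne : s ≠ 0 := by rintro rfl; simp at hs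
    have h1 := three_le_of_mem h0 h (sup_mem hne)
    have h2 := sup_le_sum s
    omega
  rw [h, zero_add]
  exact numWith_pos {3} (by simp) (by simp) (by simp)

/-- The only negative difference is the -1 at argument 1. For odd `x ≥ 3`, whenever it appears, so
does the gain from 2 to 3, which cancels it. -/
theorem neg_ite_le_sum_numAvoiding (J : ℕ) (x : ℤ) :
    (if x = 1 then -1 else 0) ≤ ∑ l ∈ Finset.range J,
      (numAvoiding (x - 2 * l) {2, 1} - numAvoiding (x - 2 * l - 1) {2, 1}) := by
  induction J generalizing x with
  | zero => split_ifs <;> simp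
  | succ J ih =>
    rw [Finset.sum_range_succ']
    have h := ih (x - 2)
    have h1 : ∀ l : ℕ, x - 2 - 2 * l = x - 2 * (l + 1 : ℕ) := fun l => by push_cast; ring
    simp only [h1] at h
    simp only [Nat.cast_zero, mul_zero, sub_zero]
    by_cases hx1 : x = 1
    · subst hx1
      rw [if_neg (by norm_num)] at h
      have h2 := numAvoiding_zero
      have h3 : 0 ≤ numAvoiding 1 {2, 1} := numWith_nonneg _ _
      simp only [if_true, sub_self]
      linarith
    · have h2 := numAvoiding_mono hx1
      rw [if_neg hx1]
      by_cases hx3 : x = 3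
      · subst hx3
        rw [if_pos (by norm_num)] at h
        have h3 := numAvoiding_two_lt_three
        rw [show (3 : ℤ) - 1 = 2 by norm_num]
        linarith
      · rw [if_neg (by omega)] at h
        linarith

/-- Uses 1 - q^(2j+2) = (1 - q²)(1 + q² + ⋯ + q^(2j)), where the factor 1 - q² removes 2 from the
allowed parts. -/
theorem neg_ite_le_avoidingDiff (x : ℤ) (j : ℕ) :
    (if x = 1 then -1 else 0) ≤ avoidingDiff x 1 (2 * j + 2) := by
  refine (neg_ite_le_sum_numAvoiding (j + 1) x).trans_eq ?_
  have h1 := Finset.sum_range_sub' (fun l : ℕ => numAvoiding (x - 2 * l) {1}) (j + 1)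
  have h2 := Finset.sum_range_sub' (fun l : ℕ => numAvoiding (x - 2 * l - 1) {1}) (j + 1)
  simp only [numAvoiding_sub_two]
  rw [Finset.sum_sub_distrib]
  have h3 : ∀ l : ℕ, x - 2 * l - 2 = x - 2 * (l + 1 : ℕ) := fun l => by push_cast; ring
  have h4 : ∀ l : ℕ, x - 2 * l - 1 - 2 = x - 2 * (l + 1 : ℕ) - 1 := fun l => by push_cast; ring
  simp only [h3, h4]
  rw [h1, h2, avoidingDiff]
  push_cast
  rw [sub_zero, show x - 2 * (j + 1 : ℤ) = x - (2 * j + 2) by ring,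
    show x - (2 * j + 2 : ℤ) - 1 = x - 1 - (2 * j + 2) by ring]
  ring

/-! ### Regrouping the double sum -/

theorem sum_range_two_mul_alternating (g : ℕ → ℤ) (R : ℕ) :
    ∑ k ∈ Finset.range (2 * R), (-1) ^ k * g k =
      ∑ r ∈ Finset.range R, (g (2 * r) - g (2 * r + 1)) := by
  induction R with
  | zero => simp
  | succ R ih =>
    rw [mul_add_one, Finset.sum_range_succ, Finset.sum_range_succ, ih, Finset.sum_range_succ,
      pow_succ, pow_mul]
    norm_num
    ring

theorem sum_range_two_mul_pairs (f : ℕ → ℤ) (R : ℕ) :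
    ∑ m ∈ Finset.range (2 * R), f m = ∑ i ∈ Finset.range R, (f (2 * i) + f (2 * i + 1)) := by
  induction R with
  | zero => simp
  | succ R ih =>
    rw [mul_add_one, Finset.sum_range_succ, Finset.sum_range_succ, ih, Finset.sum_range_succ]
    ring

theorem crankExp_odd (r m : ℕ) : crankExp (2 * r + 1) m = (2 * r + 1) * (r + m) := by
  have h := two_mul_triangular (2 * r + 1)
  unfold crankExp
  push_cast at h ⊢
  linarith

theorem crankExp_even (r m : ℕ) :
    crankExp (2 * r + 1 + 1) m = (r + 1) * (2 * r + 1 + 2 * m) := by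
  have h := two_mul_triangular (2 * r + 1 + 1)
  unfold crankExp
  push_cast at h ⊢
  linarith

/-- Four neighbouring terms of the alternating double sum `∑ (-1) ^ (k - 1) φ (crankExp k m)`. -/
def quadruple (φ : ℤ → ℤ) (i j : ℕ) : ℤ :=
  φ (crankExp (2 * (i + j) + 1) (2 * i + 1)) - φ (crankExp (2 * (i + j) + 1 + 1) (2 * i + 1)) +
    (φ (crankExp (2 * (i + j) + 1) (2 * i + 2)) - φ (crankExp (2 * (i + j) + 1 + 1) (2 * i + 2)))

/-- The 2 × 2 blocks tile the region m ≤ k, except that for odd k = 2r+1 they also include m = k+1;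
the subtracted term removes this excess. -/
theorem alternating_sum_eq_sum_quadruple (φ : ℤ → ℤ) (R : ℕ) :
    ∑ k ∈ Finset.range (2 * R),
      (-1) ^ k * ∑ m ∈ Finset.range (k + 1), φ (crankExp (k + 1) (m + 1)) =
    ∑ i ∈ Finset.range R,
      (∑ j ∈ Finset.range (R - i), quadruple φ i j - φ ((2 * i + 1) * (3 * i + 2))) := by
  rw [sum_range_two_mul_alternating
    fun k => ∑ m ∈ Finset.range (k + 1), φ (crankExp (k + 1) (m + 1)),
    Finset.sum_sub_distrib (f := fun i => ∑ j ∈ Finset.range (R - i), quadruple φ i j),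
    ← Finset.sum_range_diag_flip, ← Finset.sum_sub_distrib]
  refine Finset.sum_congr rfl fun r _ => ?_
  have h1 := Finset.sum_range_succ (fun m => φ (crankExp (2 * r + 1) (m + 1))) (2 * r + 1)
  have h2 := sum_range_two_mul_pairs
    (fun m => φ (crankExp (2 * r + 1) (m + 1)) - φ (crankExp (2 * r + 1 + 1) (m + 1))) (r + 1)
  have h3 : ∑ i ∈ Finset.range (r + 1), quadruple φ i (r - i) = ∑ i ∈ Finset.range (r + 1),
      (φ (crankExp (2 * r + 1) (2 * i + 1)) - φ (crankExp (2 * r + 1 + 1) (2 * i + 1)) +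
      (φ (crankExp (2 * r + 1) (2 * i + 1 + 1)) - φ (crankExp (2 * r + 1 + 1) (2 * i + 1 + 1)))) :=
    Finset.sum_congr rfl fun i hi => by
      rw [quadruple, Nat.add_sub_cancel' (Nat.lt_succ_iff.1 (Finset.mem_range.1 hi))]
  have h4 : crankExp (2 * r + 1) (2 * r + 1 + 1) = (2 * r + 1) * (3 * r + 2) := by
    rw [crankExp_odd]; push_cast; ring
  rw [h4] at h1
  rw [h3, ← h2, mul_add_one, Finset.sum_sub_distrib]
  linarith

/-- The pairs with m = 2i+2 and m = 2i+1 supply the entries at `x` and `x - d` of the first and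
second `avoidingDiff`. Of the four remaining entries two cancel, and the other two are corrected by
a difference telescoping in `j`. -/
theorem quadruple_eq (x : ℤ) (i j : ℕ) :
    quadruple (fun e => numAvoiding (x - e) {1}) i j =
      avoidingDiff (x - (6 * i ^ 2 + 8 * i * j + 2 * j ^ 2 + 7 * i + 5 * j + 2))
          (4 * i + 2) (4 * i + 2 * j + 3) +
        avoidingDiff (x - (6 * i ^ 2 + 8 * i * j + 2 * j ^ 2 + 5 * i + 3 * j + 1))
          (2 * i + 1) (4 * i + 2 * j + 2) +
        (numAvoiding (x - (6 * i ^ 2 + 8 * i * j + 2 * j ^ 2 + 7 * i + 3 * j + 2)) {1} -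
          numAvoiding (x - (6 * i ^ 2 + 8 * i * (j + 1 : ℕ) + 2 * (j + 1 : ℕ) ^ 2 + 7 * i +
            3 * (j + 1 : ℕ) + 2)) {1}) := by
  unfold quadruple avoidingDiff
  simp only [crankExp_odd, crankExp_even]
  push_cast
  ring_nf

theorem ospt_diff_eq_sum {N R : ℕ} (hN : 1 ≤ N) (hR : N + 1 ≤ R) :
    ospt (N + 1) - ospt N = ∑ i ∈ Finset.range R, ∑ j ∈ Finset.range (R - i),
      (avoidingDiff (N + 1 - (6 * i ^ 2 + 8 * i * j + 2 * j ^ 2 + 7 * i + 5 * j + 2))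
          (4 * i + 2) (4 * i + 2 * j + 3) +
        avoidingDiff (N + 1 - (6 * i ^ 2 + 8 * i * j + 2 * j ^ 2 + 5 * i + 3 * j + 1))
          (2 * i + 1) (4 * i + 2 * j + 2)) := by
  have h : ospt (N + 1) - ospt N = ∑ k ∈ Finset.range (2 * R), (-1) ^ k *
      ∑ m ∈ Finset.range (k + 1), numAvoiding (N + 1 - crankExp (k + 1) (m + 1)) {1} := by
    rw [ospt_eq_sum (K := 2 * R) (by omega) (by omega), ospt_eq_sum (K := 2 * R) hN (by omega),
      ← Finset.sum_sub_distrib]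
    refine Finset.sum_congr rfl fun k _ => ?_
    rw [← mul_sub, ← Finset.sum_sub_distrib]
    congr 1
    refine Finset.sum_congr rfl fun m _ => ?_
    rw [← numPartitions_sub]
    push_cast
    congr 2
    ring
  rw [h, alternating_sum_eq_sum_quadruple fun e => numAvoiding (N + 1 - e) {1}]
  refine Finset.sum_congr rfl fun i hi => ?_
  rw [Finset.mem_range] at hi
  simp only [quadruple_eq]
  rw [Finset.sum_add_distrib, Finset.sum_range_sub' fun j : ℕ =>
    numAvoiding (N + 1 - (6 * i ^ 2 + 8 * i * j + 2 * j ^ 2 + 7 * i + 3 * j + 2 : ℤ)) {1}]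
  -- The far end of the telescoping sum vanishes, its exponent exceeding `N + 1`; the end `j = 0`
  -- cancels the excess term at (2i+1)(3i+2).
  rw [numAvoiding_of_neg (x := N + 1 - (6 * i ^ 2 + 8 * i * (R - i : ℕ) + _ + _ + _ + _))]
  · rw [Nat.cast_zero, show (6 * i ^ 2 + 8 * i * 0 + 2 * 0 ^ 2 + 7 * i + 3 * 0 + 2 : ℤ) =
      (2 * i + 1) * (3 * i + 2) by ring]
    ring
  · have h1 : (N : ℤ) + 1 ≤ i + (R - i : ℕ) := by omega
    generalize R - i = j at *
    have h2 : (0 : ℤ) ≤ 6 * i ^ 2 + 8 * i * j + 2 * j ^ 2 := by positivity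
    omega

/-! ### Monotonicity -/

theorem ospt_mono {N : ℕ} (hN : 1 ≤ N) : ospt N ≤ ospt (N + 1) := by
  -- Only the row `i = 0` involves `c = 1`, so it is split off.
  rw [← sub_nonneg, ospt_diff_eq_sum hN le_rfl, Finset.sum_range_succ']
  refine add_nonneg (Finset.sum_nonneg fun i _ => Finset.sum_nonneg fun j _ => add_nonneg
    (avoidingDiff_nonneg _ (by omega) (by omega) (by omega))
    (avoidingDiff_nonneg _ (by omega) (by omega) (by omega))) ?_
  simp only [Nat.cast_zero, mul_zero, zero_add, add_zero, zero_mul, ne_eq, OfNat.ofNat_ne_zero,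
    not_false_eq_true, zero_pow, Nat.sub_zero]
  have hA : ∀ j : ℕ, 0 ≤ avoidingDiff (N + 1 - (2 * j ^ 2 + 5 * j + 2)) 2 (2 * j + 3) :=
    fun j => avoidingDiff_nonneg _ (by omega) (by omega) (by omega)
  have hB : ∀ j : ℕ, (if (N + 1 - (2 * j ^ 2 + 3 * j + 1) : ℤ) = 1 then -1 else 0) ≤
      avoidingDiff (N + 1 - (2 * j ^ 2 + 3 * j + 1)) 1 (2 * j + 2) :=
    fun j => neg_ite_le_avoidingDiff _ j
  by_cases hj : ∃ j : ℕ, (N + 1 - (2 * j ^ 2 + 3 * j + 1) : ℤ) = 1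
  · obtain ⟨j, hj⟩ := hj
    rw [Finset.sum_add_distrib]
    have hjN : j ∈ Finset.range (N + 1) := by
      rw [Finset.mem_range]
      have : (0 : ℤ) ≤ (j : ℤ) ^ 2 := by positivity
      omega
    have h1 : 1 ≤ ∑ j ∈ Finset.range (N + 1),
        avoidingDiff (N + 1 - (2 * j ^ 2 + 5 * j + 2)) 2 (2 * j + 3) := by
      refine le_trans ?_ (Finset.single_le_sum (fun j _ => hA j) (Finset.mem_range.2 N.succ_pos))
      rw [avoidingDiff_eq _ le_rfl (by omega) (by omega)]
      simp only [Nat.cast_zero, mul_zero, zero_add, ne_eq, OfNat.ofNat_ne_zero,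
        not_false_eq_true, zero_pow, add_zero]
      -- A deficit means N = (2j+1)(j+1). For `j = 0` the empty partition of `N - 1 = 0`
      -- compensates; otherwise `N ≥ 6` and the single part `N - 1` does.
      obtain rfl | hj0 := Nat.eq_zero_or_pos j
      · refine numWith_pos 0 ?_ (by simp) (by simp)
        simp at hj ⊢
        linarith
      · have hN6 : 5 ≤ N - 1 := by
          have h2 : (1 : ℤ) ≤ j := by exact_mod_cast hj0
          have h3 : (1 : ℤ) ≤ (j : ℤ) ^ 2 := one_le_pow₀ h2
          omega
        refine numWith_pos {N - 1} ?_ ?_ ?_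
        · rw [sum_singleton]; omega
        · rw [mem_singleton]; omega
        · intro d hd
          simp only [Finset.mem_insert, Finset.mem_singleton] at hd
          rw [mem_singleton]; omega
    have h2 : -1 ≤ ∑ j ∈ Finset.range (N + 1),
        avoidingDiff (N + 1 - (2 * j ^ 2 + 3 * j + 1)) 1 (2 * j + 2) := by
      refine le_trans ?_ (Finset.sum_le_sum fun j _ => hB j)
      rw [Finset.sum_eq_single_of_mem j hjN, if_pos hj]
      intro i _ hij
      refine if_neg fun hi => hij ?_
      have h3 : ((i : ℤ) - j) * (2 * (i + j) + 3) = 0 := by linear_combination hj - hi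
      rcases mul_eq_zero.1 h3 with h3 | h3 <;> omega
    linarith
  · refine Finset.sum_nonneg fun j _ => add_nonneg (hA j) ?_
    have h := hB j
    rwa [if_neg fun h => hj ⟨j, h⟩] at h

end PartitionMoments

theorem lemma5p1 (N : ℕ) (hN : 1 ≤ N) :
    PartitionMoments.ospt N ≤ PartitionMoments.ospt (N + 1) :=
  PartitionMoments.ospt_mono hN
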